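/- Let $\mathbb{R}^-=(-\infty,0]$ and let $w\in C^1(\mathbb{R}^-;\mathbb{R})$ be a weight with $w>0$ and $w'/w$ bounded. Put $L^2_w=L^2(\mathbb{R}^-,w(\xi)\,d\xi;\mathbb{R})$ and let $H_w=\mathbb{R}\times L^2_w$ be the product Hilbert space, with elements $\mathbf{x}=(x_0,x_1)$. A function $f\in L^2_{loc}(\mathbb{R}^-)$ has weak derivative $f'=g\in L^2_{loc}(\mathbb{R}^-)$ if $\int_{\mathbb{R}^-} f\varphi'\,d\xi=-\int_{\mathbb{R}^-} g\varphi\,d\xi$ for all $\varphi\in C^1_c((-\infty,0);\mathbb{R})$; such an $f$ has a locally absolutely continuous version on $\mathbb{R}^-$, and $f(0)$ denotes the value of that version at $0$. Let $W^{1,2}_w$ be the set of such $f$ with $\int_{\mathbb{R}^-}(|f|^2+|f'|^2)\,w\,d\xi<\infty$. For every $t\ge 0$ the formula $$T(t)\mathbf{x}=\Big(x_0,\ x_0\mathbf{1}_{(0,t]}(t+\cdot)+x_1(t+\cdot)\mathbf{1}_{\mathbb{R}^-}(t+\cdot)\Big)$$ defines a bounded linear operator on $H_w$, and the family $(T(t))_{t\ge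 0}$ is a strongly continuous semigroup on $H_w$. Its generator is the closed unbounded operator $\mathcal{A}$ with domain $$D(\mathcal{A})=\{\mathbf{x}=(x_0,x_1)\in H_w \mid x_1\in W^{1,2}_w,\ x_0=x_1(0)\},\qquad \mathcal{A}\mathbf{x}=(0,x_1').$$ -/

import Mathlib

open MeasureTheory Set Filter Topology
open scoped NNReal ENNReal

namespace DelayShift

/-! ### Strongly continuous semigroups and their generators -/

/-- A strongly continuous semigroup of bounded linear operators `(T t)_{t ≥ 0}`. -/
structure IsC0Semigroup {E : Type*} [NormedAddCommGroup E] [NormedSpace ℝ E]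
    (T : ℝ≥0 → E →L[ℝ] E) : Prop where
  map_zero : T 0 = ContinuousLinearMap.id ℝ E
  map_add : ∀ s t : ℝ≥0, T (s + t) = (T s).comp (T t)
  continuous_orbit : ∀ x : E, Continuous fun t : ℝ≥0 => T t x

/-- `A` is the (infinitesimal) generator of `T`: its domain consists of exactly those `x` for which
the right derivative at `0` of the orbit `t ↦ T t x` exists, and `A x` is that derivative. -/
structure IsGenerator {E : Type*} [NormedAddCommGroup E] [NormedSpace ℝ E]
    (T : ℝ≥0 → E →L[ℝ] E) (A : E →ₗ.[ℝ] E) : Prop where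
  mem_domain_iff : ∀ x : E, x ∈ A.domain ↔
    ∃ y : E, Tendsto (fun t : ℝ≥0 => (t : ℝ)⁻¹ • (T t x - x)) (𝓝[>] 0) (𝓝 y)
  tendsto : ∀ x : A.domain,
    Tendsto (fun t : ℝ≥0 => (t : ℝ)⁻¹ • (T t (x : E) - (x : E))) (𝓝[>] 0) (𝓝 (A x))

/-! ### The weight and the weighted spaces on `ℝ⁻ = (-∞, 0]` -/

/-- `w ∈ C¹(ℝ⁻)`, `w > 0` and `w' / w` is bounded on `ℝ⁻`; values outside `ℝ⁻` play no role. -/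
structure IsWeight (w : ℝ → ℝ) : Prop where
  contDiffOn : ContDiffOn ℝ 1 w (Iic 0)
  pos : ∀ ξ ∈ Iic (0 : ℝ), 0 < w ξ
  bounded : ∃ K : ℝ, ∀ ξ ∈ Iic (0 : ℝ), |derivWithin w (Iic 0) ξ / w ξ| ≤ K

/-- The measure `w(ξ) dξ` on `ℝ⁻`. -/
noncomputable def weightMeasure (w : ℝ → ℝ) : Measure ℝ :=
  (volume.restrict (Iic 0)).withDensity fun ξ => ENNReal.ofReal (w ξ)

/-- `L²_w = L²(ℝ⁻, w(ξ) dξ; ℝ)`. -/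
abbrev L2w (w : ℝ → ℝ) : Type := Lp ℝ 2 (weightMeasure w)

/-- The Hilbert space `H_w = ℝ × L²_w`, with the Hilbertian product norm. -/
abbrev Hw (w : ℝ → ℝ) : Type := WithLp 2 (ℝ × L2w w)

/-- `f ∈ L²_loc(ℝ⁻)`: square integrable on every compact subinterval `[a, 0]` of `ℝ⁻`. -/
def MemL2loc (f : ℝ → ℝ) : Prop :=
  ∀ a : ℝ, MemLp f 2 (volume.restrict (Icc a 0))

/-- `g` is a weak derivative of `f` on `(-∞, 0)`, both functions being in `L²_loc(ℝ⁻)`. -/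
structure HasWeakDeriv (f g : ℝ → ℝ) : Prop where
  left : MemL2loc f
  right : MemL2loc g
  integral_eq : ∀ φ : ℝ → ℝ, ContDiff ℝ 1 φ → HasCompactSupport φ → tsupport φ ⊆ Iio 0 →
    ∫ ξ in Iic 0, f ξ * deriv φ ξ = -∫ ξ in Iic 0, g ξ * φ ξ

/-- `f ∈ W^{1,2}_w`: `f` has a weak derivative, and both lie in `L²_w`. -/
def MemW12 (w f : ℝ → ℝ) : Prop :=
  MemLp f 2 (weightMeasure w) ∧ ∃ g, HasWeakDeriv f g ∧ MemLp g 2 (weightMeasure w)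

/-- `f(0) = c`, read on the locally absolutely continuous version of `f` on `ℝ⁻`. -/
def HasValueAtZero (f : ℝ → ℝ) (c : ℝ) : Prop :=
  ∃ F : ℝ → ℝ, (∀ a ≤ 0, AbsolutelyContinuousOnInterval F a 0) ∧
    f =ᵐ[volume.restrict (Iic 0)] F ∧ F 0 = c

/-! ### The shift operators -/

/-- The function `ξ ↦ x₀ 1_{(0,t]}(t+ξ) + x₁(t+ξ) 1_{ℝ⁻}(t+ξ)`. -/
noncomputable def shiftFun (t : ℝ≥0) (x₀ : ℝ) (x₁ : ℝ → ℝ) (ξ : ℝ) : ℝ :=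
  x₀ * (Ioc (0 : ℝ) t).indicator 1 (t + ξ) + x₁ (t + ξ) * (Iic (0 : ℝ)).indicator 1 (t + ξ)

/-- The bounded operators `T t` on `H_w` act by
`T t x = (x₀, x₀ 1_{(0,t]}(t+·) + x₁(t+·) 1_{ℝ⁻}(t+·))`. -/
def IsShiftFamily (w : ℝ → ℝ) (T : ℝ≥0 → Hw w →L[ℝ] Hw w) : Prop :=
  ∀ (t : ℝ≥0) (x : Hw w), (T t x).fst = x.fst ∧
    (T t x).snd =ᵐ[weightMeasure w] shiftFun t x.fst x.snd

/-! ### Facts needed to define the operator `𝒜` -/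

theorem weightMeasure_ac (w : ℝ → ℝ) : weightMeasure w ≪ volume.restrict (Iic 0) :=
  withDensity_absolutelyContinuous _ _

theorem IsWeight.ac {w : ℝ → ℝ} (hw : IsWeight w) :
    volume.restrict (Iic 0) ≪ weightMeasure w := by
  refine withDensity_absolutelyContinuous' ?_ ?_
  · exact (hw.contDiffOn.continuousOn.aemeasurable measurableSet_Iic).ennreal_ofReal
  · filter_upwards [ae_restrict_mem measurableSet_Iic] with ξ hξ
    simpa using hw.pos ξ hξ

theorem IsWeight.ae_eq {w : ℝ → ℝ} (hw : IsWeight w) {f g : ℝ → ℝ}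
    (h : f =ᵐ[weightMeasure w] g) : f =ᵐ[volume.restrict (Iic 0)] g :=
  hw.ac.ae_le h

theorem MemL2loc.congr {f g : ℝ → ℝ} (hf : MemL2loc f)
    (h : f =ᵐ[volume.restrict (Iic 0)] g) : MemL2loc g := fun a =>
  (hf a).ae_eq (ae_restrict_of_ae_restrict_of_subset Icc_subset_Iic_self h)

theorem MemL2loc.locallyIntegrable {f : ℝ → ℝ} (hf : MemL2loc f) :
    LocallyIntegrable ((Iic (0 : ℝ)).indicator f) := by
  rw [locallyIntegrable_iff]
  intro k hk
  obtain ⟨a, ha⟩ := hk.bddBelow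
  rw [integrableOn_indicator_iff measurableSet_Iic]
  have h1 : IntegrableOn f (Icc a 0) := (hf a).integrable (by norm_num)
  exact h1.mono_set fun x hx => ⟨ha hx.2, hx.1⟩

theorem MemL2loc.integrable_mul {f ψ : ℝ → ℝ} (hf : MemL2loc f) (hψ : Continuous ψ)
    (hc : HasCompactSupport ψ) : IntegrableOn (fun ξ => f ξ * ψ ξ) (Iic 0) := by
  have h := hf.locallyIntegrable.integrable_smul_right_of_hasCompactSupport hψ hc
  refine (integrable_indicator_iff measurableSet_Iic).1 (h.congr (Eventually.of_forall fun x => ?_))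
  by_cases hx : x ∈ Iic (0 : ℝ) <;> simp [indicator, hx]

theorem HasWeakDeriv.congr {f f' g g' : ℝ → ℝ} (h : HasWeakDeriv f g)
    (hf : f =ᵐ[volume.restrict (Iic 0)] f') (hg : g =ᵐ[volume.restrict (Iic 0)] g') :
    HasWeakDeriv f' g' where
  left := h.left.congr hf
  right := h.right.congr hg
  integral_eq φ h1 h2 h3 := by
    have e1 : ∫ ξ in Iic 0, f ξ * deriv φ ξ = ∫ ξ in Iic 0, f' ξ * deriv φ ξ :=
      integral_congr_ae (hf.mul (ae_eq_refl (deriv φ)))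
    have e2 : ∫ ξ in Iic 0, g ξ * φ ξ = ∫ ξ in Iic 0, g' ξ * φ ξ :=
      integral_congr_ae (hg.mul (ae_eq_refl φ))
    rw [← e1, ← e2]
    exact h.integral_eq φ h1 h2 h3

theorem HasWeakDeriv.add {f f' g g' : ℝ → ℝ} (h : HasWeakDeriv f g) (h' : HasWeakDeriv f' g') :
    HasWeakDeriv (f + f') (g + g') where
  left a := (h.left a).add (h'.left a)
  right a := (h.right a).add (h'.right a)
  integral_eq φ h1 h2 h3 := by
    have hd : Continuous (deriv φ) := h1.continuous_deriv le_rfl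
    simp only [Pi.add_apply, add_mul]
    rw [integral_add (h.left.integrable_mul hd h2.deriv) (h'.left.integrable_mul hd h2.deriv),
      integral_add (h.right.integrable_mul h1.continuous h2)
        (h'.right.integrable_mul h1.continuous h2),
      h.integral_eq φ h1 h2 h3, h'.integral_eq φ h1 h2 h3]
    ring

theorem HasWeakDeriv.const_smul {f g : ℝ → ℝ} (c : ℝ) (h : HasWeakDeriv f g) :
    HasWeakDeriv (c • f) (c • g) where
  left a := (h.left a).const_smul c
  right a := (h.right a).const_smul c
  integral_eq φ h1 h2 h3 := by
    simp only [Pi.smul_apply, smul_eq_mul, mul_assoc]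
    rw [integral_const_mul, integral_const_mul, h.integral_eq φ h1 h2 h3]
    ring

theorem HasWeakDeriv.unique {f g g' : ℝ → ℝ} (h : HasWeakDeriv f g) (h' : HasWeakDeriv f g') :
    g =ᵐ[volume.restrict (Iic 0)] g' := by
  have hl : MemL2loc (g - g') := fun a => (h.right a).sub (h'.right a)
  have key := isOpen_Iio (a := (0 : ℝ)) |>.ae_eq_zero_of_integral_contDiff_smul_eq_zero
    (μ := volume) (f := (Iic (0 : ℝ)).indicator (g - g'))
    (hl.locallyIntegrable.locallyIntegrableOn _) (by
      intro φ h1 h2 h3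
      have h1' : ContDiff ℝ 1 φ := h1.of_le (by norm_cast)
      have e1 := h.integral_eq φ h1' h2 h3
      have e2 := h'.integral_eq φ h1' h2 h3
      have e3 : (fun ξ => φ ξ • (Iic (0 : ℝ)).indicator (g - g') ξ)
          = (Iic (0 : ℝ)).indicator (fun ξ => g ξ * φ ξ - g' ξ * φ ξ) := by
        funext ξ
        by_cases hx : ξ ∈ Iic (0 : ℝ)
        · simp only [indicator_of_mem hx, Pi.sub_apply, smul_eq_mul]; ring
        · simp [indicator_of_notMem hx]
      rw [e3, integral_indicator measurableSet_Iic,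
        integral_sub (h.right.integrable_mul h1.continuous h2)
          (h'.right.integrable_mul h1.continuous h2)]
      linarith)
  rw [← restrict_Iio_eq_restrict_Iic]
  filter_upwards [ae_restrict_of_ae key, ae_restrict_mem measurableSet_Iio] with ξ hξ hm
  have := hξ hm
  rw [indicator_of_mem (mem_Iic.2 (le_of_lt hm))] at this
  exact sub_eq_zero.1 this

/-! ### The operator `𝒜` -/

/-- `{x = (x₀, x₁) ∈ H_w : x₁ ∈ W^{1,2}_w, x₀ = x₁(0)}`. -/
def domA (w : ℝ → ℝ) (hw : IsWeight w) : Submodule ℝ (Hw w) where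
  carrier := {x | MemW12 w x.snd ∧ HasValueAtZero x.snd x.fst}
  zero_mem' := by
    have h0 : ((0 : L2w w) : ℝ → ℝ) =ᵐ[volume.restrict (Iic 0)] 0 :=
      hw.ae_eq (Lp.coeFn_zero _ _ _)
    refine ⟨⟨Lp.memLp _, 0, ?_, MemLp.zero⟩, 0, ?_, h0, rfl⟩
    · have hz : HasWeakDeriv (0 : ℝ → ℝ) 0 :=
        ⟨fun a => MemLp.zero, fun a => MemLp.zero, fun φ _ _ _ => by simp⟩
      exact hz.congr h0.symm (ae_eq_refl _)
    · intro a _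
      exact (LipschitzWith.const (0 : ℝ)).lipschitzOnWith.absolutelyContinuousOnInterval
  add_mem' := by
    rintro x y ⟨⟨_, g, hg, hg2⟩, F, hF, hxF, hF0⟩ ⟨⟨_, g', hg', hg2'⟩, F', hF', hyF, hF0'⟩
    have h0 : ((x.snd + y.snd : L2w w) : ℝ → ℝ) =ᵐ[volume.restrict (Iic 0)] x.snd + y.snd :=
      hw.ae_eq (Lp.coeFn_add _ _)
    refine ⟨⟨Lp.memLp _, g + g', (hg.add hg').congr h0.symm (ae_eq_refl _), hg2.add hg2'⟩,
      F + F', fun a ha => (hF a ha).add (hF' a ha), h0.trans (hxF.add hyF), ?_⟩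
    simp [hF0, hF0']
  smul_mem' := by
    rintro c x ⟨⟨_, g, hg, hg2⟩, F, hF, hxF, hF0⟩
    have h0 : ((c • x.snd : L2w w) : ℝ → ℝ) =ᵐ[volume.restrict (Iic 0)] c • ⇑x.snd :=
      hw.ae_eq (Lp.coeFn_smul _ _)
    refine ⟨⟨Lp.memLp _, c • g, (hg.const_smul c).congr h0.symm (ae_eq_refl _), hg2.const_smul c⟩,
      c • F, fun a ha => (hF a ha).const_smul c, h0.trans (hxF.const_smul c), ?_⟩
    simp [hF0]

/-- The weak derivative `x₁' ∈ L²_w` of the second component of an element of the domain. -/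
noncomputable def weakDeriv {w : ℝ → ℝ} {hw : IsWeight w} (x : domA w hw) : L2w w :=
  x.2.1.2.choose_spec.2.toLp x.2.1.2.choose

theorem weakDeriv_spec {w : ℝ → ℝ} {hw : IsWeight w} (x : domA w hw) :
    HasWeakDeriv (x : Hw w).snd (weakDeriv x) :=
  x.2.1.2.choose_spec.1.congr (ae_eq_refl _)
    (hw.ae_eq (MemLp.coeFn_toLp x.2.1.2.choose_spec.2)).symm

theorem weakDeriv_eq {w : ℝ → ℝ} {hw : IsWeight w} (x : domA w hw) (y : L2w w)
    (h : HasWeakDeriv (x : Hw w).snd y) : weakDeriv x = y :=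
  Lp.ext ((weightMeasure_ac w).ae_le ((weakDeriv_spec x).unique h))

/-- The operator `𝒜 x = (0, x₁')` with domain `domA`. -/
noncomputable def opA (w : ℝ → ℝ) (hw : IsWeight w) : Hw w →ₗ.[ℝ] Hw w where
  domain := domA w hw
  toFun :=
    { toFun := fun x => WithLp.toLp 2 (0, weakDeriv x)
      map_add' := fun x y => by
        have h : weakDeriv (x + y) = weakDeriv x + weakDeriv y :=
          weakDeriv_eq _ _ (((weakDeriv_spec x).add (weakDeriv_spec y)).congr
            (hw.ae_eq (Lp.coeFn_add _ _)).symm (hw.ae_eq (Lp.coeFn_add _ _)).symm)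
        rw [h, ← WithLp.toLp_add, Prod.mk_add_mk, add_zero]
      map_smul' := fun c x => by
        have h : weakDeriv (c • x) = c • weakDeriv x :=
          weakDeriv_eq _ _ (((weakDeriv_spec x).const_smul c).congr
            (hw.ae_eq (Lp.coeFn_smul _ _)).symm (hw.ae_eq (Lp.coeFn_smul _ _)).symm)
        rw [h, RingHom.id_apply, ← WithLp.toLp_smul, Prod.smul_mk, smul_zero] }

end DelayShift

/-! The bound on `w'/w` says that translating the weight costs at most a factor `exp (K t)`. Hence
the left shift, cut off at `-t`, is bounded on `L²_w` with norm at most `exp (K t / 2)`. `T(t)x` is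
this shift of `x₁` plus `x₀` times the indicator of `(-t, 0]`. Strong continuity follows by density
of compactly supported continuous functions. The semigroup law holds because `T(t)x` is a window,
translated by `t`, on the extension of `x₁` by the constant `x₀` to the right of `0`.

The generator is handled through the integrated relation `IsPrimitive x y`: `y₀ = 0` and `x₁(ξ) = x₀
+ ∫_0^ξ y₁` almost everywhere. It describes the graph of `opA` (`isPrimitive_opA`,
`IsPrimitive.exists_opA_eq`). It also follows from existence of the derivative `y` of the orbit of
`x` at `0` (`isPrimitive_of_tendsto`), and it implies `T(t)x - x = ∫_0^t T(s)y ds` for all `t`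
(`IsPrimitive.eq_integral`), which gives back that derivative. So the three conditions on `(x, y)`
are equivalent. The first and third identify the generator. The integral identity is closed in `(x,
y)`, so the graph is closed.

Vector identities are tested on the functionals `f ↦ ∫_a^0 f`, which are continuous on `L²_w` and
separate points. Unboundedness comes from steep ramps near `0`. -/

namespace DelayShift

variable {w : ℝ → ℝ}

/-! ### The weight measure -/

/-- From `w' ≥ -K w` the function `w(ξ) exp(Kξ)` is nondecreasing; comparing its values at `ξ - t`
and `ξ` gives the bound. -/
theorem IsWeight.exists_le_exp_mul (hw : IsWeight w) :
    ∃ K : ℝ, 0 ≤ K ∧ ∀ t : ℝ, 0 ≤ t → ∀ ξ ≤ (0 : ℝ), w (ξ - t) ≤ Real.exp (K * t) * w ξ := by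
  obtain ⟨K, hK⟩ := hw.bounded
  refine ⟨K, (abs_nonneg _).trans (hK 0 self_mem_Iic), fun t ht ξ hξ => ?_⟩
  have hmono : MonotoneOn (fun ξ => w ξ * Real.exp (K * ξ)) (Iic 0) := by
    have hd : ∀ x ∈ Iio (0 : ℝ), HasDerivAt (fun ξ => w ξ * Real.exp (K * ξ))
        (derivWithin w (Iic 0) x * Real.exp (K * x) + w x * (Real.exp (K * x) * K)) x := by
      intro x hx
      have hx' : x ∈ Iic (0 : ℝ) := Iio_subset_Iic_self hx
      have h1 : HasDerivAt w (derivWithin w (Iic 0) x) x :=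
        ((hw.contDiffOn.differentiableOn one_ne_zero x hx').hasDerivWithinAt).hasDerivAt
          (Iic_mem_nhds hx)
      have h2 : HasDerivAt (fun ξ => Real.exp (K * ξ)) (Real.exp (K * x) * K) x := by
        simpa using ((hasDerivAt_id x).const_mul K).exp
      exact h1.mul h2
    refine monotoneOn_of_deriv_nonneg (convex_Iic 0) ?_ ?_ ?_
    · exact hw.contDiffOn.continuousOn.mul (by fun_prop)
    · rw [interior_Iic]
      exact fun x hx => (hd x hx).differentiableAt.differentiableWithinAt
    · rw [interior_Iic]
      intro x hx
      rw [(hd x hx).deriv]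
      have hx' : x ∈ Iic (0 : ℝ) := Iio_subset_Iic_self hx
      have h3 := (abs_le.1 (hK x hx')).1
      rw [le_div_iff₀ (hw.pos x hx')] at h3
      nlinarith [Real.exp_pos (K * x)]
  have h := hmono (show ξ - t ∈ Iic (0 : ℝ) by simp; linarith) hξ (by linarith)
  have h4 : Real.exp (K * t) * Real.exp (K * (ξ - t)) = Real.exp (K * ξ) := by
    rw [← Real.exp_add]; ring_nf
  simp only [← h4] at h
  have h5 := Real.exp_pos (K * (ξ - t))
  refine le_of_mul_le_mul_right ?_ h5
  linarith

theorem weightMeasure_apply {s : Set ℝ} (hs : MeasurableSet s) :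
    weightMeasure w s = ∫⁻ ξ in s ∩ Iic 0, ENNReal.ofReal (w ξ) := by
  rw [weightMeasure, withDensity_apply _ hs, Measure.restrict_restrict hs]

/-- By translation invariance of Lebesgue measure the image measure has density `w(η - t)` at `η ≤
0`. Domination by a multiple of the weight measure yields measurability, transport of null sets and
the `L²` bound for the shift. -/
theorem map_weightMeasure_le {c t : ℝ} (hc : 0 ≤ c) (ht : 0 ≤ t)
    (h : ∀ ξ ≤ (0 : ℝ), w (ξ - t) ≤ c * w ξ) :
    ((weightMeasure w).restrict (Iic (-t))).map (fun ξ => t + ξ)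
      ≤ ENNReal.ofReal c • weightMeasure w := by
  refine Measure.le_iff.2 fun s hs => ?_
  have hm : Measurable fun ξ : ℝ => t + ξ := by fun_prop
  rw [Measure.map_apply hm hs, Measure.restrict_apply (hm hs),
    weightMeasure_apply ((hm hs).inter measurableSet_Iic), Measure.smul_apply,
    weightMeasure_apply hs, smul_eq_mul, ← lintegral_const_mul' _ _ ENNReal.ofReal_ne_top]
  have e : (fun ξ : ℝ => t + ξ) ⁻¹' s ∩ Iic (-t) ∩ Iic 0
      = (fun ξ : ℝ => t + ξ) ⁻¹' (s ∩ Iic 0) := by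
    ext ξ
    simp only [mem_inter_iff, mem_preimage, mem_Iic]
    constructor
    · rintro ⟨⟨h1, h2⟩, h3⟩; exact ⟨h1, by linarith⟩
    · rintro ⟨h1, h2⟩; exact ⟨⟨h1, by linarith⟩, by linarith⟩
  have hs' : MeasurableSet (s ∩ Iic 0) := hs.inter measurableSet_Iic
  rw [e, ← lintegral_indicator (hm hs'), ← lintegral_indicator hs',
    ← lintegral_add_left_eq_self ((s ∩ Iic 0).indicator _) t]
  refine lintegral_mono fun ξ => ?_
  by_cases hξ : t + ξ ∈ s ∩ Iic 0
  · rw [indicator_of_mem hξ, indicator_of_mem (show ξ ∈ (fun ξ : ℝ => t + ξ) ⁻¹' (s ∩ Iic 0) from hξ),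
      ← ENNReal.ofReal_mul hc]
    have := h (t + ξ) hξ.2
    rw [add_sub_cancel_left] at this
    exact ENNReal.ofReal_le_ofReal this
  · rw [indicator_of_notMem (show ξ ∉ (fun ξ : ℝ => t + ξ) ⁻¹' (s ∩ Iic 0) from hξ)]
    exact zero_le

theorem IsWeight.exists_between_Icc (hw : IsWeight w) {a : ℝ} (ha : a ≤ 0) :
    ∃ m M : ℝ, 0 < m ∧ 0 < M ∧ ∀ ξ ∈ Icc a 0, m ≤ w ξ ∧ w ξ ≤ M := by
  have hc : ContinuousOn w (Icc a 0) := hw.contDiffOn.continuousOn.mono Icc_subset_Iic_self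
  have hne : (Icc a 0).Nonempty := nonempty_Icc.2 ha
  obtain ⟨p, hp, hpm⟩ := isCompact_Icc.exists_isMinOn hne hc
  obtain ⟨q, hq, hqm⟩ := isCompact_Icc.exists_isMaxOn hne hc
  exact ⟨w p, w q, hw.pos p hp.2, hw.pos q hq.2, fun ξ hξ => ⟨hpm hξ, hqm hξ⟩⟩

theorem weightMeasure_le_of_subset_Icc {a M : ℝ} (h : ∀ ξ ∈ Icc a 0, w ξ ≤ M) {s : Set ℝ}
    (hs : MeasurableSet s) (hsa : s ∩ Iic 0 ⊆ Icc a 0) :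
    weightMeasure w s ≤ ENNReal.ofReal M * volume s := by
  rw [weightMeasure_apply hs]
  calc ∫⁻ ξ in s ∩ Iic 0, ENNReal.ofReal (w ξ)
      ≤ ∫⁻ _ in s ∩ Iic 0, ENNReal.ofReal M :=
        setLIntegral_mono' (hs.inter measurableSet_Iic)
          fun ξ hξ => ENNReal.ofReal_le_ofReal (h ξ (hsa hξ))
    _ ≤ ENNReal.ofReal M * volume s := by
        rw [setLIntegral_const]
        gcongr
        exact inter_subset_left

theorem le_weightMeasure_of_subset_Icc {a m : ℝ} (h : ∀ ξ ∈ Icc a 0, m ≤ w ξ) {s : Set ℝ}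
    (hs : MeasurableSet s) (hsa : s ⊆ Icc a 0) :
    ENNReal.ofReal m * volume s ≤ weightMeasure w s := by
  rw [weightMeasure_apply hs, inter_eq_left.2 (hsa.trans Icc_subset_Iic_self),
    ← setLIntegral_const]
  exact setLIntegral_mono' hs fun ξ hξ => ENNReal.ofReal_le_ofReal (h ξ (hsa hξ))

theorem IsWeight.isLocallyFiniteMeasure (hw : IsWeight w) :
    IsLocallyFiniteMeasure (weightMeasure w) := by
  refine ⟨fun x => ⟨Ioo (x - 1) (x + 1), Ioo_mem_nhds (by linarith) (by linarith), ?_⟩⟩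
  obtain ⟨m, M, -, -, hM⟩ := hw.exists_between_Icc (a := min (x - 1) 0) (min_le_right _ _)
  refine (weightMeasure_le_of_subset_Icc (fun ξ hξ => (hM ξ hξ).2) measurableSet_Ioo ?_).trans_lt ?_
  · exact fun ξ hξ => ⟨(min_le_left _ _).trans hξ.1.1.le, hξ.2⟩
  · rw [Real.volume_Ioo]
    exact ENNReal.mul_lt_top ENNReal.ofReal_lt_top ENNReal.ofReal_lt_top

/-- A positive continuous weight has a positive minimum `m` on a compact interval, so `c = 1/m`
works. This makes restriction from `L²_w` to `L²([a, 0])` well defined and continuous. -/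
theorem IsWeight.volume_restrict_Icc_le (hw : IsWeight w) (a : ℝ) :
    ∃ c : ℝ≥0∞, c ≠ ∞ ∧ volume.restrict (Icc a 0) ≤ c • weightMeasure w := by
  rcases le_or_gt a 0 with ha | ha
  · obtain ⟨m, M, hm, -, hM⟩ := hw.exists_between_Icc ha
    refine ⟨(ENNReal.ofReal m)⁻¹, by simpa using hm, Measure.le_iff.2 fun s hs => ?_⟩
    have hm0 : ENNReal.ofReal m ≠ 0 := by simpa using hm
    have hs' : MeasurableSet (s ∩ Icc a 0) := hs.inter measurableSet_Icc
    rw [Measure.restrict_apply hs, Measure.smul_apply, smul_eq_mul]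
    calc volume (s ∩ Icc a 0)
        = (ENNReal.ofReal m)⁻¹ * (ENNReal.ofReal m * volume (s ∩ Icc a 0)) := by
          rw [← mul_assoc, ENNReal.inv_mul_cancel hm0 ENNReal.ofReal_ne_top, one_mul]
      _ ≤ (ENNReal.ofReal m)⁻¹ * weightMeasure w s := by
          gcongr
          exact (le_weightMeasure_of_subset_Icc (fun ξ hξ => (hM ξ hξ).1) hs'
            inter_subset_right).trans (measure_mono inter_subset_left)
  · refine ⟨1, ENNReal.one_ne_top, ?_⟩
    rw [Icc_eq_empty (not_le.2 ha), Measure.restrict_empty]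
    exact Measure.zero_le _

theorem IsWeight.memL2loc (hw : IsWeight w) {f : ℝ → ℝ} (hf : MemLp f 2 (weightMeasure w)) :
    MemL2loc f := fun a => by
  obtain ⟨c, hc, h⟩ := hw.volume_restrict_Icc_le a
  exact hf.of_measure_le_smul hc h

/-! ### The shift operators -/

/-- Null sets pull back to null sets under the shift, so shifting respects almost-everywhere
classes. -/
theorem shift_ae {t : ℝ} {c : ℝ} (hc : 0 ≤ c) (ht : 0 ≤ t)
    (h : ∀ ξ ≤ (0 : ℝ), w (ξ - t) ≤ c * w ξ) {p : ℝ → Prop} (hp : ∀ᵐ ξ ∂weightMeasure w, p ξ) :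
    ∀ᵐ ξ ∂weightMeasure w, t + ξ ≤ 0 → p (t + ξ) := by
  have h1 : ∀ᵐ ξ ∂((weightMeasure w).restrict (Iic (-t))).map (fun ξ => t + ξ), p ξ :=
    (Measure.absolutelyContinuous_of_le_smul (map_weightMeasure_le hc ht h)).ae_le hp
  have h2 := ae_of_ae_map (by fun_prop) h1
  rw [ae_restrict_iff' measurableSet_Iic] at h2
  filter_upwards [h2] with ξ hξ h3
  exact hξ (by simp; linarith)

/-- The left shift `ξ ↦ f (t + ξ)`, extended by `0`. -/
noncomputable def zeroShift (t : ℝ) (f : ℝ → ℝ) : ℝ → ℝ :=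
  (Iic (-t)).indicator fun ξ => f (t + ξ)

theorem zeroShift_aestronglyMeasurable {t c : ℝ} (hc : 0 ≤ c) (ht : 0 ≤ t)
    (h : ∀ ξ ≤ (0 : ℝ), w (ξ - t) ≤ c * w ξ) {f : ℝ → ℝ}
    (hf : AEStronglyMeasurable f (weightMeasure w)) :
    AEStronglyMeasurable (zeroShift t f) (weightMeasure w) := by
  rw [zeroShift, aestronglyMeasurable_indicator_iff measurableSet_Iic]
  have h1 : AEStronglyMeasurable f
      (((weightMeasure w).restrict (Iic (-t))).map (fun ξ => t + ξ)) :=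
    hf.mono_ac (Measure.absolutelyContinuous_of_le_smul (map_weightMeasure_le hc ht h))
  exact h1.comp_measurable (by fun_prop)

theorem eLpNorm_zeroShift_le {t c : ℝ} (hc : 0 ≤ c) (ht : 0 ≤ t)
    (h : ∀ ξ ≤ (0 : ℝ), w (ξ - t) ≤ c * w ξ) {f : ℝ → ℝ}
    (hf : AEStronglyMeasurable f (weightMeasure w)) :
    eLpNorm (zeroShift t f) 2 (weightMeasure w)
      ≤ ENNReal.ofReal c ^ (1 / 2 : ℝ) * eLpNorm f 2 (weightMeasure w) := by
  have h1 : AEStronglyMeasurable f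
      (((weightMeasure w).restrict (Iic (-t))).map (fun ξ => t + ξ)) :=
    hf.mono_ac (Measure.absolutelyContinuous_of_le_smul (map_weightMeasure_le hc ht h))
  rw [zeroShift, eLpNorm_indicator_eq_eLpNorm_restrict measurableSet_Iic]
  change eLpNorm (f ∘ fun ξ => t + ξ) 2 _ ≤ _
  rw [← eLpNorm_map_measure h1 (by fun_prop)]
  simpa using eLpNorm_le_of_measure_le_smul (p := 2) (f := f) (map_weightMeasure_le hc ht h)

theorem exists_zeroShiftL (hw : IsWeight w) : ∃ (K : ℝ) (S : ℝ≥0 → L2w w →L[ℝ] L2w w), 0 ≤ K ∧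
    (∀ t f, S t f =ᵐ[weightMeasure w] zeroShift t f) ∧
    ∀ t f, ‖S t f‖ ≤ Real.exp (K * t) ^ (1 / 2 : ℝ) * ‖f‖ := by
  obtain ⟨K, hK, h⟩ := hw.exists_le_exp_mul
  have hmem : ∀ (t : ℝ≥0) (f : L2w w), MemLp (zeroShift t f) 2 (weightMeasure w) := fun t f =>
    ⟨zeroShift_aestronglyMeasurable (Real.exp_pos (K * t)).le t.coe_nonneg (h t t.coe_nonneg)
      (Lp.aestronglyMeasurable f),
      (eLpNorm_zeroShift_le (Real.exp_pos (K * t)).le t.coe_nonneg (h t t.coe_nonneg)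
        (Lp.aestronglyMeasurable f)).trans_lt
        (ENNReal.mul_lt_top (by finiteness) (Lp.eLpNorm_lt_top f))⟩
  let S₀ : (t : ℝ≥0) → L2w w →ₗ[ℝ] L2w w := fun t =>
    { toFun := fun f => (hmem t f).toLp _
      map_add' := fun f g => by
        rw [← MemLp.toLp_add, MemLp.toLp_eq_toLp_iff]
        filter_upwards [shift_ae (Real.exp_pos (K * t)).le t.coe_nonneg (h t t.coe_nonneg) (Lp.coeFn_add f g)]
          with ξ hξ
        by_cases hm : ξ ∈ Iic (-(t : ℝ))
        · have := hξ (by simp at hm; linarith)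
          simpa [zeroShift, hm] using this
        · simp only [zeroShift, Pi.add_apply, indicator_of_notMem hm, add_zero]
      map_smul' := fun a f => by
        rw [RingHom.id_apply, ← MemLp.toLp_const_smul, MemLp.toLp_eq_toLp_iff]
        filter_upwards [shift_ae (Real.exp_pos (K * t)).le t.coe_nonneg (h t t.coe_nonneg) (Lp.coeFn_smul a f)]
          with ξ hξ
        by_cases hm : ξ ∈ Iic (-(t : ℝ))
        · have := hξ (by simp at hm; linarith)
          simpa [zeroShift, hm] using this
        · simp only [zeroShift, Pi.smul_apply, indicator_of_notMem hm, smul_zero] }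
  have hb : ∀ t f, ‖S₀ t f‖ ≤ Real.exp (K * t) ^ (1 / 2 : ℝ) * ‖f‖ := fun t f => by
    change ‖(hmem t f).toLp _‖ ≤ _
    rw [Lp.norm_toLp, Lp.norm_def]
    have h1 := eLpNorm_zeroShift_le (Real.exp_pos (K * t)).le t.coe_nonneg (h t t.coe_nonneg)
        (Lp.aestronglyMeasurable f)
    have h2 := ENNReal.toReal_mono (ENNReal.mul_ne_top (by finiteness) (Lp.eLpNorm_ne_top f)) h1
    rwa [ENNReal.toReal_mul, ← ENNReal.toReal_rpow,
      ENNReal.toReal_ofReal (Real.exp_pos (K * t)).le] at h2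
  exact ⟨K, fun t => (S₀ t).mkContinuous _ (hb t), hK, fun t f => (hmem t f).coeFn_toLp, hb⟩

/-! ### Strong continuity of the shift -/

theorem ae_weightMeasure_le_zero : ∀ᵐ ξ ∂weightMeasure w, ξ ≤ 0 :=
  (weightMeasure_ac w).ae_le (ae_restrict_mem measurableSet_Iic)

theorem ae_weightMeasure_ne (a : ℝ) : ∀ᵐ ξ ∂weightMeasure w, ξ ≠ a :=
  (weightMeasure_ac w).ae_le (ae_restrict_of_ae (Measure.ae_ne volume a))

/-- The cutoff jumps at `ξ = -t₀`; away from that single null point it is locally constant in `t`.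
-/
theorem tendsto_zeroShift_apply {f : ℝ → ℝ} (hf : Continuous f) {t₀ : ℝ≥0} {ξ : ℝ}
    (hξ : ξ ≠ -t₀) :
    Tendsto (fun t : ℝ≥0 => zeroShift t f ξ) (𝓝 t₀) (𝓝 (zeroShift t₀ f ξ)) := by
  rcases lt_or_gt_of_ne hξ with h | h
  · have h1 : Tendsto (fun t : ℝ≥0 => f (t + ξ)) (𝓝 t₀) (𝓝 (f (t₀ + ξ))) :=
      Continuous.tendsto (by fun_prop) t₀
    have h2 : ∀ᶠ t : ℝ≥0 in 𝓝 t₀, ξ < -(t : ℝ) :=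
      (isOpen_lt continuous_const (by fun_prop)).mem_nhds h
    have h3 : zeroShift t₀ f ξ = f (t₀ + ξ) := indicator_of_mem (mem_Iic.2 h.le) _
    rw [h3]
    refine h1.congr' ?_
    filter_upwards [h2] with t ht
    exact (indicator_of_mem (mem_Iic.2 ht.le) fun ξ : ℝ => f (t + ξ)).symm
  · have h2 : ∀ᶠ t : ℝ≥0 in 𝓝 t₀, -(t : ℝ) < ξ :=
      (isOpen_lt (by fun_prop) continuous_const).mem_nhds h
    have h3 : zeroShift t₀ f ξ = 0 := indicator_of_notMem (by simpa using h) _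
    rw [h3]
    refine tendsto_const_nhds.congr' ?_
    filter_upwards [h2] with t ht
    exact (indicator_of_notMem (s := Iic (-(t : ℝ))) (by simpa using ht) _).symm

/-- Dominated convergence: for `t ≤ t₀ + 1` the shifts are bounded by one constant and vanish
outside one compact interval, which has finite weight. -/
theorem tendsto_eLpNorm_zeroShift_sub (hw : IsWeight w) {f : ℝ → ℝ} (hf : Continuous f)
    (hc : HasCompactSupport f) (t₀ : ℝ≥0) :
    Tendsto (fun t : ℝ≥0 => eLpNorm (zeroShift t f - zeroShift t₀ f) 2 (weightMeasure w))
      (𝓝 t₀) (𝓝 0) := by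
  have := hw.isLocallyFiniteMeasure
  obtain ⟨C, hC⟩ := hc.exists_bound_of_continuous hf
  obtain ⟨R, hR⟩ := hc.isCompact.isBounded.subset_closedBall 0
  have hC0 : 0 ≤ C := (norm_nonneg _).trans (hC 0)
  have hb : ∀ (t : ℝ≥0) ξ, ‖zeroShift t f ξ‖ ≤ C := fun t ξ => by
    rw [zeroShift, norm_indicator_eq_indicator_norm]
    exact indicator_le' (fun _ _ => hC _) (fun _ _ => hC0) ξ
  -- A nonzero value forces `ξ ≤ -t ≤ 0` and `t + ξ ≥ -R`, hence `ξ ≥ -R - t`.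
  have hsupp : ∀ t : ℝ≥0, t ≤ t₀ + 1 → ∀ ξ ∉ Icc (-(R + t₀ + 1)) 0, zeroShift t f ξ = 0 := by
    intro t ht ξ hξ
    have ht' : (t : ℝ) ≤ t₀ + 1 := by exact_mod_cast ht
    by_cases h : ξ ∈ Iic (-(t : ℝ))
    · rw [zeroShift, indicator_of_mem h]
      by_contra hne
      have h1 := hR (subset_tsupport f hne)
      rw [Metric.mem_closedBall, dist_zero_right, Real.norm_eq_abs, abs_le] at h1
      have h2 : ξ ≤ -(t : ℝ) := h
      exact hξ ⟨by linarith, by linarith [t.coe_nonneg]⟩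
    · exact indicator_of_notMem h _
  have hmeas : ∀ t : ℝ≥0, StronglyMeasurable (zeroShift t f) := fun t =>
    StronglyMeasurable.indicator (Continuous.stronglyMeasurable (by fun_prop)) measurableSet_Iic
  have key : Tendsto (fun t : ℝ≥0 =>
      ∫⁻ ξ, ‖(zeroShift t f - zeroShift t₀ f) ξ‖ₑ ^ (2 : ℝ) ∂weightMeasure w) (𝓝 t₀)
      (𝓝 (∫⁻ _, 0 ∂weightMeasure w)) := by
    refine tendsto_lintegral_filter_of_dominated_convergence
      ((Icc (-(R + t₀ + 1)) 0).indicator fun _ => ENNReal.ofReal (C + C) ^ (2 : ℝ)) ?_ ?_ ?_ ?_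
    · exact Eventually.of_forall fun t =>
        (((hmeas t).sub (hmeas t₀)).enorm).pow_const _
    · have h1 : ∀ᶠ t : ℝ≥0 in 𝓝 t₀, t ≤ t₀ + 1 := Iic_mem_nhds (by simp)
      filter_upwards [h1] with t ht
      refine Eventually.of_forall fun ξ => ?_
      by_cases hξ : ξ ∈ Icc (-(R + t₀ + 1)) 0
      · rw [indicator_of_mem hξ]
        gcongr
        rw [← ofReal_norm]
        refine ENNReal.ofReal_le_ofReal ((norm_sub_le _ _).trans ?_)
        gcongr <;> apply hb
      · rw [Pi.sub_apply, hsupp t ht ξ hξ, hsupp t₀ (by simp) ξ hξ]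
        simp
    · rw [lintegral_indicator measurableSet_Icc, setLIntegral_const]
      exact ENNReal.mul_ne_top (by finiteness) isCompact_Icc.measure_lt_top.ne
    · filter_upwards [ae_weightMeasure_ne (w := w) (-t₀)] with ξ hξ
      have h1 := ((tendsto_zeroShift_apply hf hξ).sub_const (zeroShift t₀ f ξ)).enorm
      rw [sub_self, enorm_zero] at h1
      simpa [Function.comp_def] using
        ((ENNReal.continuous_rpow_const (y := 2)).tendsto 0).comp h1
  have h2 := (ENNReal.continuous_rpow_const (y := 1 / 2)).tendsto _ |>.comp key
  simp only [lintegral_zero] at h2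
  rw [ENNReal.zero_rpow_of_pos (by norm_num)] at h2
  refine h2.congr fun t => ?_
  rw [eLpNorm_eq_lintegral_rpow_enorm_toReal (by norm_num) (by norm_num)]
  simp

/-- Density argument: the norms of `S t` are bounded by `B` for `t ≤ t₀ + 1`, so orbits of compactly
supported continuous functions approximate the orbit of `f` uniformly near `t₀`. -/
theorem continuous_zeroShiftL (hw : IsWeight w) {K : ℝ} (hK : 0 ≤ K)
    {S : ℝ≥0 → L2w w →L[ℝ] L2w w} (hS : ∀ t f, S t f =ᵐ[weightMeasure w] zeroShift t f)
    (hb : ∀ t f, ‖S t f‖ ≤ Real.exp (K * t) ^ (1 / 2 : ℝ) * ‖f‖) (f : L2w w) :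
    Continuous fun t => S t f := by
  have := hw.isLocallyFiniteMeasure
  refine continuous_of_locally_uniform_approx_of_continuousAt fun t₀ u hu => ?_
  obtain ⟨ε, hε, hεu⟩ := Metric.mem_uniformity_dist.1 hu
  set B : ℝ := Real.exp (K * (t₀ + 1)) ^ (1 / 2 : ℝ) with hB
  have hB0 : 0 < B := Real.rpow_pos_of_pos (Real.exp_pos _) _
  obtain ⟨g, hgc, hfg, hg, hgm⟩ := (Lp.memLp f).exists_hasCompactSupport_eLpNorm_sub_le
    (by norm_num) (ε := ENNReal.ofReal (ε / (2 * B))) (by simp; positivity)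
  have hdist : ‖f - hgm.toLp g‖ ≤ ε / (2 * B) := by
    have e : f - hgm.toLp g = ((Lp.memLp f).sub hgm).toLp _ := by
      rw [MemLp.toLp_sub (Lp.memLp f) hgm, Lp.toLp_coeFn]
    rw [e, Lp.norm_toLp]
    exact ENNReal.toReal_le_of_le_ofReal (by positivity) hfg
  refine ⟨Iic (t₀ + 1), Iic_mem_nhds (by simp), fun t => S t (hgm.toLp g), ?_, fun t ht => ?_⟩
  · have hSg : ∀ t, S t (hgm.toLp g) =ᵐ[weightMeasure w] zeroShift t g := fun t => by
      refine (hS t _).trans ?_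
      obtain ⟨K', -, h⟩ := hw.exists_le_exp_mul
      filter_upwards [shift_ae (Real.exp_pos (K' * t)).le t.coe_nonneg (h t t.coe_nonneg)
        hgm.coeFn_toLp] with ξ hξ
      by_cases hm : ξ ∈ Iic (-(t : ℝ))
      · have := hξ (by simp at hm; linarith)
        simpa [zeroShift, hm] using this
      · simp only [zeroShift, indicator_of_notMem hm]
    rw [ContinuousAt, Lp.tendsto_Lp_iff_tendsto_eLpNorm']
    refine (tendsto_eLpNorm_zeroShift_sub hw hg hgc t₀).congr fun t => ?_
    exact eLpNorm_congr_ae ((hSg t).sub (hSg t₀)).symm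
  · apply hεu
    have ht' : (t : ℝ) ≤ t₀ + 1 := by exact_mod_cast ht
    rw [dist_eq_norm, ← map_sub]
    calc ‖S t (f - hgm.toLp g)‖ ≤ Real.exp (K * t) ^ (1 / 2 : ℝ) * ‖f - hgm.toLp g‖ := hb _ _
      _ ≤ B * (ε / (2 * B)) := by rw [hB]; gcongr
      _ = ε / 2 := by field_simp
      _ < ε := half_lt_self hε

/-- The two intervals differ only between `-t` and `-t₀`, a set of weight at most `M |t - t₀|`. This
yields continuity in `L²_w` of the indicator of `(-t, 0]`. -/
theorem tendsto_weightMeasure_symmDiff_Ioc (hw : IsWeight w) (t₀ : ℝ≥0) :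
    Tendsto (fun t : ℝ≥0 => weightMeasure w (symmDiff (Ioc (-(t : ℝ)) 0) (Ioc (-(t₀ : ℝ)) 0)))
      (𝓝 t₀) (𝓝 0) := by
  obtain ⟨m, M, -, hM0, hM⟩ := hw.exists_between_Icc (a := -((t₀ : ℝ) + 1))
    (by linarith [t₀.coe_nonneg])
  have h1 : Tendsto (fun t : ℝ≥0 => ENNReal.ofReal M * ENNReal.ofReal |(t : ℝ) - t₀|) (𝓝 t₀)
      (𝓝 0) := by
    have h2 : Tendsto (fun t : ℝ≥0 => |(t : ℝ) - t₀|) (𝓝 t₀) (𝓝 |(t₀ : ℝ) - t₀|) :=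
      Continuous.tendsto (by fun_prop) t₀
    have h3 := ENNReal.Tendsto.const_mul (a := ENNReal.ofReal M) (ENNReal.tendsto_ofReal h2)
      (Or.inr ENNReal.ofReal_ne_top)
    simpa using h3
  refine tendsto_of_tendsto_of_tendsto_of_le_of_le' tendsto_const_nhds h1
    (Eventually.of_forall fun _ => zero_le) ?_
  have h4 : ∀ᶠ t : ℝ≥0 in 𝓝 t₀, t ≤ t₀ + 1 := Iic_mem_nhds (by simp)
  filter_upwards [h4] with t ht
  have ht' : (t : ℝ) ≤ t₀ + 1 := by exact_mod_cast ht
  refine (weightMeasure_le_of_subset_Icc (fun ξ hξ => (hM ξ hξ).2)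
    (measurableSet_Ioc.symmDiff measurableSet_Ioc) ?_).trans ?_
  · rintro ξ ⟨h | h, -⟩
    · exact ⟨by linarith [h.1.1], h.1.2⟩
    · exact ⟨by linarith [h.1.1], h.1.2⟩
  · gcongr
    refine (measure_mono (t := uIcc (-(t : ℝ)) (-t₀)) ?_).trans ?_
    · rintro ξ (⟨h, h'⟩ | ⟨h, h'⟩)
      · refine Icc_subset_uIcc ⟨h.1.le, ?_⟩
        by_contra hlt
        exact h' ⟨not_le.1 hlt, h.2⟩
      · refine Icc_subset_uIcc' ⟨h.1.le, ?_⟩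
        by_contra hlt
        exact h' ⟨not_le.1 hlt, h.2⟩
    · rw [Real.volume_interval]
      refine ENNReal.ofReal_le_ofReal (le_of_eq ?_)
      congr 1; ring

/-! ### The semigroup -/

theorem shiftFun_eq (t : ℝ≥0) (x₀ : ℝ) (x₁ : ℝ → ℝ) {ξ : ℝ} (hξ : ξ ≤ 0) :
    shiftFun t x₀ x₁ ξ = if t + ξ ≤ 0 then x₁ (t + ξ) else x₀ := by
  by_cases h : (t : ℝ) + ξ ≤ 0
  · simp [shiftFun, h]
  · have h' : (t : ℝ) + ξ ∈ Ioc (0 : ℝ) t := ⟨not_le.1 h, by linarith⟩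
    simp only [shiftFun, indicator_of_mem h', if_neg h]
    rw [indicator_of_notMem (by simpa using h)]
    simp

theorem exists_isShiftFamily (hw : IsWeight w) : ∃ T : ℝ≥0 → Hw w →L[ℝ] Hw w,
    IsShiftFamily w T ∧ ∀ x, Continuous fun t => T t x := by
  have := hw.isLocallyFiniteMeasure
  obtain ⟨K, S, hK, hS, hb⟩ := exists_zeroShiftL hw
  have hfin : ∀ t : ℝ≥0, weightMeasure w (Ioc (-(t : ℝ)) 0) ≠ ∞ := fun t =>
    measure_Ioc_lt_top.ne
  -- For `ξ ≤ 0`, the condition `t + ξ ∈ (0, t]` reads `ξ ∈ (-t, 0]`.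
  let u : ℝ≥0 → L2w w := fun t => indicatorConstLp 2 measurableSet_Ioc (hfin t) (1 : ℝ)
  let T : ℝ≥0 → Hw w →L[ℝ] Hw w := fun t =>
    ((WithLp.prodContinuousLinearEquiv 2 ℝ ℝ (L2w w)).symm : ℝ × L2w w →L[ℝ] Hw w).comp
      ((WithLp.fstL 2 ℝ ℝ (L2w w)).prod
        ((WithLp.fstL 2 ℝ ℝ (L2w w)).smulRight (u t) + (S t).comp (WithLp.sndL 2 ℝ ℝ (L2w w))))
  have hT : ∀ t x, T t x = WithLp.toLp 2 (x.fst, x.fst • u t + S t x.snd) := fun t x => rfl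
  refine ⟨T, fun t x => ⟨rfl, ?_⟩, fun x => ?_⟩
  · rw [hT]
    filter_upwards [Lp.coeFn_add (x.fst • u t) (S t x.snd), Lp.coeFn_smul x.fst (u t),
      hS t x.snd, indicatorConstLp_coeFn (p := 2) (hs := measurableSet_Ioc) (hμs := hfin t)
        (c := (1 : ℝ)), ae_weightMeasure_le_zero (w := w)] with ξ h1 h2 h3 h4 h5
    change (x.fst • u t + S t x.snd : L2w w) ξ = _
    rw [h1, Pi.add_apply, h2, Pi.smul_apply, h3, h4, shiftFun_eq t _ _ h5]
    by_cases h : (t : ℝ) + ξ ≤ 0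
    · have h6 : ξ ∈ Iic (-(t : ℝ)) := by simp; linarith
      have h7 : ξ ∉ Ioc (-(t : ℝ)) 0 := fun h' => by linarith [h'.1]
      rw [if_pos h, zeroShift, indicator_of_mem h6, indicator_of_notMem h7]
      simp
    · have h6 : ξ ∉ Iic (-(t : ℝ)) := by simp; linarith
      have h7 : ξ ∈ Ioc (-(t : ℝ)) 0 := ⟨by linarith, h5⟩
      rw [if_neg h, zeroShift, indicator_of_notMem h6, indicator_of_mem h7]
      simp
  · simp only [hT]
    have hu : Continuous u :=
      continuous_indicatorConstLp_set (by norm_num) fun t => tendsto_weightMeasure_symmDiff_Ioc hw t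
    have h1 := continuous_zeroShiftL hw hK hS hb x.snd
    exact (WithLp.prod_continuous_toLp 2 ℝ (L2w w)).comp
      (continuous_const.prodMk ((hu.const_smul x.fst).add h1))

theorem Hw.ext_ae {x y : Hw w} (h : x.fst = y.fst) (h' : x.snd =ᵐ[weightMeasure w] y.snd) :
    x = y := by
  have h'' : x.snd = y.snd := Lp.ext h'
  exact WithLp.ofLp_injective 2 (Prod.ext h h'')

theorem IsShiftFamily.isC0Semigroup (hw : IsWeight w) {T : ℝ≥0 → Hw w →L[ℝ] Hw w}
    (hT : IsShiftFamily w T) (hc : ∀ x, Continuous fun t => T t x) : IsC0Semigroup T where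
  map_zero := by
    ext1 x
    refine Hw.ext_ae (hT 0 x).1 ?_
    filter_upwards [(hT 0 x).2, ae_weightMeasure_le_zero (w := w)] with ξ h h'
    rw [h, shiftFun_eq _ _ _ h']
    simp [h']
  map_add s t := by
    ext1 x
    refine Hw.ext_ae ?_ ?_
    · rw [(hT _ x).1, ContinuousLinearMap.comp_apply, (hT _ _).1, (hT _ _).1]
    -- The formula for `T t x` holds only almost everywhere, so it has to be carried through the
    -- shift by `s`. If `s + ξ > 0`, then `s + t + ξ > 0` too, and both sides equal `x₀`.
    · obtain ⟨K, -, h⟩ := hw.exists_le_exp_mul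
      filter_upwards [(hT (s + t) x).2, (hT s (T t x)).2, ae_weightMeasure_le_zero (w := w),
        shift_ae (Real.exp_pos (K * s)).le s.coe_nonneg (h s s.coe_nonneg) (hT t x).2]
        with ξ h1 h2 h3 h4
      rw [h1, ContinuousLinearMap.comp_apply, h2, shiftFun_eq _ _ _ h3, shiftFun_eq _ _ _ h3,
        (hT t x).1, NNReal.coe_add]
      by_cases h5 : (s : ℝ) + ξ ≤ 0
      · rw [if_pos h5, h4 h5, shiftFun_eq _ _ _ h5, add_comm (s : ℝ) t, add_assoc]
      · rw [if_neg h5, if_neg]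
        linarith [t.coe_nonneg]
  continuous_orbit := hc

/-! ### Weak derivatives and primitives -/

theorem intervalIntegrable_of_locallyIntegrable {f : ℝ → ℝ} (hf : LocallyIntegrable f) (a b : ℝ) :
    IntervalIntegrable f volume a b :=
  intervalIntegrable_iff.2
    ((hf.integrableOn_isCompact isCompact_uIcc).mono_set uIoc_subset_uIcc)

theorem integrableOn_mul_of_hasCompactSupport {f ψ : ℝ → ℝ}
    (hf : LocallyIntegrable ((Iic (0 : ℝ)).indicator f)) (hψ : Continuous ψ)
    (hc : HasCompactSupport ψ) : IntegrableOn (fun ξ => f ξ * ψ ξ) (Iic 0) := by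
  have h := hf.integrable_smul_right_of_hasCompactSupport hψ hc
  refine (integrable_indicator_iff measurableSet_Iic).1 (h.congr (Eventually.of_forall fun x => ?_))
  by_cases hx : x ∈ Iic (0 : ℝ) <;> simp [indicator, hx]

theorem locallyIntegrable_indicator_deriv {F : ℝ → ℝ}
    (hF : ∀ a ≤ 0, AbsolutelyContinuousOnInterval F a 0) :
    LocallyIntegrable ((Iic (0 : ℝ)).indicator (deriv F)) := by
  rw [locallyIntegrable_iff]
  intro k hk
  obtain ⟨a, ha⟩ := hk.bddBelow
  rw [integrableOn_indicator_iff measurableSet_Iic]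
  have h1 : IntegrableOn (deriv F) (Icc (min a 0) 0) :=
    (intervalIntegrable_iff_integrableOn_Icc_of_le (min_le_right a 0)).1
      (hF _ (min_le_right a 0)).intervalIntegrable_deriv
  exact h1.mono_set fun x hx => ⟨(min_le_left _ _).trans (ha hx.2), hx.1⟩

theorem integral_Iic_mul_eq_intervalIntegral {a : ℝ} (ha : a ≤ 0) (f : ℝ → ℝ) {ψ : ℝ → ℝ}
    (hψ : ∀ ξ ≤ a, ψ ξ = 0) :
    ∫ ξ in Iic 0, f ξ * ψ ξ = ∫ ξ in a..0, f ξ * ψ ξ := by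
  rw [intervalIntegral.integral_of_le ha]
  refine setIntegral_eq_of_subset_of_forall_sdiff_eq_zero measurableSet_Iic Ioc_subset_Iic_self ?_
  intro ξ hξ
  rw [hψ ξ ?_, mul_zero]
  by_contra h
  exact hξ.2 ⟨not_le.1 h, hξ.1⟩

/-- Integration by parts on `(-∞, 0]` against a test function supported in `(-∞, 0)`. -/
theorem integral_mul_deriv_eq_neg {F φ : ℝ → ℝ}
    (hF : ∀ a ≤ 0, AbsolutelyContinuousOnInterval F a 0) (h1 : ContDiff ℝ 1 φ)
    (h2 : HasCompactSupport φ) (h3 : tsupport φ ⊆ Iio 0) :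
    ∫ ξ in Iic 0, F ξ * deriv φ ξ = -∫ ξ in Iic 0, deriv F ξ * φ ξ := by
  obtain ⟨b, hb⟩ := h2.isCompact.bddBelow
  -- The shift by `1` puts the left endpoint strictly below the support, so `φ` and `deriv φ` vanish
  -- there and beyond.
  have ha : min b 0 - 1 ≤ 0 := by linarith [min_le_right b 0]
  have hz : ∀ ξ ≤ min b 0 - 1, ξ ∉ tsupport φ := fun ξ hξ h => by
    linarith [min_le_left b 0, hb h]
  have hφ : ∀ ξ ≤ min b 0 - 1, φ ξ = 0 := fun ξ hξ => image_eq_zero_of_notMem_tsupport (hz ξ hξ)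
  have hφ' : ∀ ξ ≤ min b 0 - 1, deriv φ ξ = 0 := fun ξ hξ =>
    image_eq_zero_of_notMem_tsupport fun h => hz ξ hξ (tsupport_deriv_subset h)
  have h0 : φ 0 = 0 := image_eq_zero_of_notMem_tsupport fun h => lt_irrefl (0 : ℝ) (h3 h)
  rw [integral_Iic_mul_eq_intervalIntegral ha _ hφ', integral_Iic_mul_eq_intervalIntegral ha _ hφ,
    (hF _ ha).integral_mul_deriv_eq_deriv_mul h1.contDiffOn.absolutelyContinuousOnInterval,
    h0, hφ _ le_rfl]
  ring

/-- Integration by parts makes `deriv F` a second weak derivative of `f`; the fundamental lemma of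
the calculus of variations identifies the two. `deriv F` is known only to be locally integrable, so
`HasWeakDeriv.unique` does not apply directly. -/
theorem HasWeakDeriv.deriv_ae_eq {f g F : ℝ → ℝ} (h : HasWeakDeriv f g)
    (hF : ∀ a ≤ 0, AbsolutelyContinuousOnInterval F a 0)
    (hfF : f =ᵐ[volume.restrict (Iic 0)] F) :
    deriv F =ᵐ[volume.restrict (Iic 0)] g := by
  have hl1 := locallyIntegrable_indicator_deriv hF
  have hl2 := h.right.locallyIntegrable
  have key := isOpen_Iio (a := (0 : ℝ)) |>.ae_eq_zero_of_integral_contDiff_smul_eq_zero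
    (μ := volume) (f := (Iic (0 : ℝ)).indicator (deriv F) - (Iic (0 : ℝ)).indicator g)
    ((hl1.sub hl2).locallyIntegrableOn _) (by
      intro φ h1 h2 h3
      have h1' : ContDiff ℝ 1 φ := h1.of_le (by norm_cast)
      have e1 := h.integral_eq φ h1' h2 h3
      have e2 := integral_mul_deriv_eq_neg hF h1' h2 h3
      have e4 : ∫ ξ in Iic 0, f ξ * deriv φ ξ = ∫ ξ in Iic 0, F ξ * deriv φ ξ :=
        integral_congr_ae (hfF.mul (ae_eq_refl (deriv φ)))
      have e3 : (fun ξ => φ ξ • ((Iic (0 : ℝ)).indicator (deriv F) - (Iic (0 : ℝ)).indicator g) ξ)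
          = (Iic (0 : ℝ)).indicator (fun ξ => deriv F ξ * φ ξ - g ξ * φ ξ) := by
        funext ξ
        by_cases hx : ξ ∈ Iic (0 : ℝ)
        · simp only [indicator_of_mem hx, Pi.sub_apply, smul_eq_mul]; ring
        · simp [indicator_of_notMem hx]
      rw [e3, integral_indicator measurableSet_Iic,
        integral_sub (integrableOn_mul_of_hasCompactSupport hl1 h1.continuous h2)
          (integrableOn_mul_of_hasCompactSupport hl2 h1.continuous h2)]
      linarith)
  rw [← restrict_Iio_eq_restrict_Iic]
  filter_upwards [ae_restrict_of_ae key, ae_restrict_mem measurableSet_Iio] with ξ hξ hm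
  have := hξ hm
  rw [Pi.sub_apply, indicator_of_mem (Iio_subset_Iic_self hm),
    indicator_of_mem (Iio_subset_Iic_self hm)] at this
  exact sub_eq_zero.1 this

/-- `y₀ = 0` and `x₁(ξ) = x₀ + ∫_0^ξ y₁` for almost every `ξ ≤ 0`. -/
def IsPrimitive (x y : Hw w) : Prop :=
  y.fst = 0 ∧ ∀ᵐ ξ ∂volume.restrict (Iic (0 : ℝ)),
    x.snd ξ = x.fst + ∫ η in 0..ξ, (Iic (0 : ℝ)).indicator y.snd η

theorem IsWeight.locallyIntegrable_indicator (hw : IsWeight w) (f : L2w w) :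
    LocallyIntegrable ((Iic (0 : ℝ)).indicator f) :=
  (hw.memL2loc (Lp.memLp f)).locallyIntegrable

theorem isPrimitive_opA (hw : IsWeight w) (x : (opA w hw).domain) :
    IsPrimitive (x : Hw w) (opA w hw x) := by
  refine ⟨rfl, ?_⟩
  change ∀ᵐ ξ ∂volume.restrict (Iic (0 : ℝ)), (x : Hw w).snd ξ = (x : Hw w).fst +
    ∫ η in 0..ξ, (Iic (0 : ℝ)).indicator (weakDeriv (hw := hw) x) η
  obtain ⟨F, hF, hxF, hF0⟩ := x.2.2
  have hd := (weakDeriv_spec (hw := hw) x).deriv_ae_eq hF hxF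
  filter_upwards [hxF, ae_restrict_mem measurableSet_Iic] with ξ hξ hm
  rw [hξ, ← hF0, intervalIntegral.integral_symm]
  have h1 : ∫ η in ξ..0, (Iic (0 : ℝ)).indicator (weakDeriv (hw := hw) x) η
      = ∫ η in ξ..0, deriv F η := by
    rw [intervalIntegral.integral_of_le hm, intervalIntegral.integral_of_le hm]
    refine integral_congr_ae ?_
    filter_upwards [ae_restrict_of_ae_restrict_of_subset Ioc_subset_Iic_self hd,
      ae_restrict_mem measurableSet_Ioc] with η h2 h3
    rw [indicator_of_mem (Ioc_subset_Iic_self h3), h2]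
  rw [h1, (hF ξ hm).integral_deriv_eq_sub]
  ring

/-- The primitive itself is the absolutely continuous version; Lebesgue differentiation gives its
derivative, and integration by parts turns that into the weak derivative. -/
theorem IsPrimitive.hasWeakDeriv (hw : IsWeight w) {x y : Hw w} (h : IsPrimitive x y) :
    HasWeakDeriv x.snd y.snd ∧ HasValueAtZero x.snd x.fst := by
  have hl := hw.locallyIntegrable_indicator y.snd
  set F : ℝ → ℝ := fun ξ => x.fst + ∫ η in 0..ξ, (Iic (0 : ℝ)).indicator y.snd η with hFdef
  have hF : ∀ a ≤ 0, AbsolutelyContinuousOnInterval F a 0 := fun a _ =>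
    ((LipschitzWith.const x.fst).lipschitzOnWith.absolutelyContinuousOnInterval).add
      ((intervalIntegrable_of_locallyIntegrable hl a 0
        ).absolutelyContinuousOnInterval_intervalIntegral (by simp))
  have hd : deriv F =ᵐ[volume.restrict (Iic 0)] y.snd := by
    filter_upwards [ae_restrict_of_ae (LocallyIntegrable.ae_hasDerivAt_integral hl),
      ae_restrict_mem measurableSet_Iic] with ξ h1 h2
    rw [((h1 0).const_add x.fst).deriv, indicator_of_mem h2]
  refine ⟨⟨hw.memL2loc (Lp.memLp _), hw.memL2loc (Lp.memLp _), fun φ h1 h2 h3 => ?_⟩,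
    F, hF, h.2, by simp [hFdef]⟩
  have e1 : ∫ ξ in Iic 0, x.snd ξ * deriv φ ξ = ∫ ξ in Iic 0, F ξ * deriv φ ξ :=
    integral_congr_ae (EventuallyEq.mul h.2 (ae_eq_refl (deriv φ)))
  have e2 : ∫ ξ in Iic 0, deriv F ξ * φ ξ = ∫ ξ in Iic 0, y.snd ξ * φ ξ :=
    integral_congr_ae (hd.mul (ae_eq_refl φ))
  rw [e1, ← e2, integral_mul_deriv_eq_neg hF h1 h2 h3]

theorem IsPrimitive.exists_opA_eq (hw : IsWeight w) {x y : Hw w} (h : IsPrimitive x y) :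
    ∃ x' : (opA w hw).domain, (x' : Hw w) = x ∧ opA w hw x' = y := by
  obtain ⟨h1, h2⟩ := h.hasWeakDeriv hw
  refine ⟨⟨x, ⟨Lp.memLp _, _, h1, Lp.memLp _⟩, h2⟩, rfl, ?_⟩
  refine WithLp.ofLp_injective 2 (Prod.ext h.1.symm ?_)
  exact weakDeriv_eq _ _ h1

/-! ### Integration over `[a, 0]` as a continuous functional -/

/-- Restriction to `L²([a, 0])` followed by the inner product with `1`. Being continuous, it
commutes with limits and Bochner integrals in `L²_w`. -/
theorem IsWeight.exists_intervalIntegralL (hw : IsWeight w) {a : ℝ} (ha : a ≤ 0) :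
    ∃ ℓ : L2w w →L[ℝ] ℝ, ∀ f : L2w w, ℓ f = ∫ ξ in a..0, f ξ := by
  obtain ⟨c, hc, h⟩ := hw.volume_restrict_Icc_le a
  refine ⟨(innerSL ℝ (indicatorConstLp 2 (MeasurableSet.univ) (measure_ne_top _ _) (1 : ℝ))).comp
    (Lp.LpToLpOfMeasureLeSMul hc h), fun f => ?_⟩
  rw [ContinuousLinearMap.comp_apply, innerSL_apply_apply, L2.inner_indicatorConstLp_one,
    setIntegral_univ, intervalIntegral.integral_of_le ha, ← integral_Icc_eq_integral_Ioc]
  exact integral_congr_ae (Lp.coeFn_LpToLpOfMeasureLeSMul hc h f)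

theorem L2w.ext_of_intervalIntegral_eq (hw : IsWeight w) {f g : L2w w}
    (h : ∀ a ≤ 0, ∫ ξ in a..0, f ξ = ∫ ξ in a..0, g ξ) : f = g := by
  have hf := hw.locallyIntegrable_indicator f
  have hg := hw.locallyIntegrable_indicator g
  have e : ∀ (k : L2w w), ∀ a ≤ 0, ∫ ξ in 0..a, (Iic (0 : ℝ)).indicator k ξ
      = -∫ ξ in a..0, k ξ := fun k a ha => by
    rw [intervalIntegral.integral_symm, intervalIntegral.integral_of_le ha,
      intervalIntegral.integral_of_le ha]
    congr 1
    exact setIntegral_congr_fun measurableSet_Ioc fun ξ hξ =>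
      indicator_of_mem (Ioc_subset_Iic_self hξ) _
  refine Lp.ext ((weightMeasure_ac w).ae_le ?_)
  change ∀ᵐ ξ ∂volume.restrict (Iic 0), f ξ = g ξ
  rw [← restrict_Iio_eq_restrict_Iic]
  filter_upwards [ae_restrict_of_ae (LocallyIntegrable.ae_hasDerivAt_integral hf),
    ae_restrict_of_ae (LocallyIntegrable.ae_hasDerivAt_integral hg), ae_restrict_mem measurableSet_Iio] with ξ h1 h2 h3
  have h4 : (fun a => ∫ ξ in 0..a, (Iic (0 : ℝ)).indicator f ξ)
      =ᶠ[𝓝 ξ] fun a => ∫ ξ in 0..a, (Iic (0 : ℝ)).indicator g ξ := by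
    filter_upwards [Iio_mem_nhds h3] with a ha
    rw [e f a (le_of_lt ha), e g a (le_of_lt ha), h a (le_of_lt ha)]
  have h5 := (h1 0).unique ((h2 0).congr_of_eventuallyEq h4)
  rwa [indicator_of_mem (Iio_subset_Iic_self h3), indicator_of_mem (Iio_subset_Iic_self h3)] at h5

/-- The function equal to `f` on `(-∞, 0]` and to `c` on `(0, ∞)`. -/
noncomputable def constExtension (c : ℝ) (f : ℝ → ℝ) (η : ℝ) : ℝ :=
  (Iic (0 : ℝ)).indicator f η + (Ioi (0 : ℝ)).indicator (fun _ => c) η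

theorem constExtension_of_le {c : ℝ} {f : ℝ → ℝ} {η : ℝ} (h : η ≤ 0) :
    constExtension c f η = f η := by
  simp [constExtension, h, not_lt.2 h]

theorem constExtension_of_lt {c : ℝ} {f : ℝ → ℝ} {η : ℝ} (h : 0 < η) :
    constExtension c f η = c := by
  simp [constExtension, h, not_le.2 h]

theorem locallyIntegrable_constExtension (hw : IsWeight w) (x : Hw w) :
    LocallyIntegrable (constExtension x.fst x.snd) :=
  (hw.locallyIntegrable_indicator x.snd).add
    ((locallyIntegrable_const x.fst).indicator measurableSet_Ioi)

theorem integral_constExtension_nonneg (c : ℝ) (f : ℝ → ℝ) {t : ℝ} (ht : 0 ≤ t) :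
    ∫ η in 0..t, constExtension c f η = t * c := by
  rw [intervalIntegral.integral_congr_uIoo (g := fun _ => c)]
  · simp
  · intro η hη
    rw [uIoo_of_le ht] at hη
    exact constExtension_of_lt hη.1

/-- On `ξ ≤ 0`, the second component of `T t x` is the constant extension evaluated at `t + ξ`, so
the window of integration moves by `t`. -/
theorem integral_shift (hw : IsWeight w) {T : ℝ≥0 → Hw w →L[ℝ] Hw w} (hT : IsShiftFamily w T)
    (t : ℝ≥0) (x : Hw w) {a : ℝ} (ha : a ≤ 0) :
    ∫ ξ in a..0, (T t x).snd ξ = ∫ η in t + a..t, constExtension x.fst x.snd η := by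
  have h1 := hw.ae_eq (hT t x).2
  have h2 : ∫ ξ in a..0, (T t x).snd ξ = ∫ ξ in a..0, constExtension x.fst x.snd (t + ξ) := by
    rw [intervalIntegral.integral_of_le ha, intervalIntegral.integral_of_le ha]
    refine integral_congr_ae ?_
    filter_upwards [ae_restrict_of_ae_restrict_of_subset Ioc_subset_Iic_self h1,
      ae_restrict_mem measurableSet_Ioc] with ξ h3 h4
    rw [h3, shiftFun_eq _ _ _ h4.2]
    split_ifs with h5
    · rw [constExtension_of_le h5]
    · rw [constExtension_of_lt (not_le.1 h5)]
  rw [h2, intervalIntegral.integral_comp_add_left, add_zero]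

/-- The windows `[a + t, t]` and `[a, 0]` differ by a gain over `[0, t]`, where the extension is
constant, and a loss over `[a, a + t]`. -/
theorem integral_shift_sub (hw : IsWeight w) {T : ℝ≥0 → Hw w →L[ℝ] Hw w}
    (hT : IsShiftFamily w T) (t : ℝ≥0) (x : Hw w) {a : ℝ} (ha : a ≤ 0) :
    (∫ ξ in a..0, (T t x).snd ξ) - ∫ ξ in a..0, x.snd ξ
      = t * x.fst - ∫ η in a..a + t, constExtension x.fst x.snd η := by
  have hi := intervalIntegrable_of_locallyIntegrable (locallyIntegrable_constExtension hw x)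
  have h1 : ∫ ξ in a..0, x.snd ξ = ∫ ξ in a..0, constExtension x.fst x.snd ξ := by
    refine intervalIntegral.integral_congr fun ξ hξ => ?_
    rw [uIcc_of_le ha] at hξ
    exact (constExtension_of_le hξ.2).symm
  rw [integral_shift hw hT t x ha, h1, ← integral_constExtension_nonneg x.fst x.snd t.coe_nonneg,
    ← intervalIntegral.integral_add_adjacent_intervals (hi (t + a) 0) (hi 0 t),
    ← intervalIntegral.integral_add_adjacent_intervals (hi a (t + a)) (hi (t + a) 0),
    add_comm a t]
  ring

/-! ### Generators and integrated orbits -/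

section Abstract

variable {E : Type*} [NormedAddCommGroup E] [NormedSpace ℝ E] {T : ℝ≥0 → E →L[ℝ] E}

theorem tendsto_coe_nhdsGT_zero : Tendsto ((↑) : ℝ≥0 → ℝ) (𝓝[>] 0) (𝓝[>] 0) := by
  refine tendsto_nhdsWithin_iff.2 ⟨?_, ?_⟩
  · exact (NNReal.continuous_coe.tendsto 0).mono_left nhdsWithin_le_nhds
  · filter_upwards [self_mem_nhdsWithin] with t ht
    exact NNReal.coe_pos.2 ht

theorem IsC0Semigroup.continuous_toNNReal (hT : IsC0Semigroup T) (y : E) :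
    Continuous fun s : ℝ => T s.toNNReal y :=
  (hT.continuous_orbit y).comp continuous_real_toNNReal

theorem IsC0Semigroup.tendsto_of_eq_integral [CompleteSpace E] (hT : IsC0Semigroup T) {x y : E}
    (h : ∀ t : ℝ≥0, T t x - x = ∫ s in (0 : ℝ)..t, T s.toNNReal y) :
    Tendsto (fun t : ℝ≥0 => (t : ℝ)⁻¹ • (T t x - x)) (𝓝[>] 0) (𝓝 y) := by
  have h1 := ((hT.continuous_toNNReal y).integral_hasStrictDerivAt 0 0).hasDerivAt
  have h2 := h1.tendsto_slope_zero_right.comp tendsto_coe_nhdsGT_zero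
  simp only [Real.toNNReal_zero, hT.map_zero, ContinuousLinearMap.id_apply] at h2
  refine h2.congr fun t => ?_
  simp [h t]

theorem IsC0Semigroup.exists_norm_le [CompleteSpace E] (hT : IsC0Semigroup T) (R : ℝ≥0) :
    ∃ M : ℝ, ∀ t ≤ R, ‖T t‖ ≤ M := by
  obtain ⟨M, hM⟩ := banach_steinhaus (g := fun t : Icc (0 : ℝ≥0) R => T t) fun x => by
    obtain ⟨C, hC⟩ := isCompact_Icc.exists_bound_of_continuousOn
      (hT.continuous_orbit x).continuousOn (s := Icc 0 R)
    exact ⟨C, fun t => hC t t.2⟩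
  exact ⟨M, fun t ht => hM ⟨t, zero_le, ht⟩⟩

/-- The uniform bound `M` on `[0, t]` makes the map Lipschitz with constant `M t`. This continuity
in `y` is what makes the graph closed. -/
theorem IsC0Semigroup.continuous_integral [CompleteSpace E] (hT : IsC0Semigroup T) (t : ℝ≥0) :
    Continuous fun y => ∫ s in (0 : ℝ)..t, T s.toNNReal y := by
  obtain ⟨M, hM⟩ := hT.exists_norm_le t
  have hM0 : 0 ≤ M := (norm_nonneg _).trans (hM t le_rfl)
  refine (LipschitzWith.of_dist_le_mul (K := M.toNNReal * t) fun y z => ?_).continuous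
  rw [dist_eq_norm, dist_eq_norm, ← intervalIntegral.integral_sub
    ((hT.continuous_toNNReal y).intervalIntegrable _ _)
    ((hT.continuous_toNNReal z).intervalIntegrable _ _)]
  refine (intervalIntegral.norm_integral_le_of_norm_le_const (C := M * ‖y - z‖)
    fun s hs => ?_).trans (le_of_eq ?_)
  · rw [uIoc_of_le t.coe_nonneg] at hs
    rw [← map_sub]
    exact (T _).le_of_opNorm_le (hM _ (Real.toNNReal_le_iff_le_coe.2 hs.2)) _
  · rw [sub_zero, abs_of_nonneg t.coe_nonneg, NNReal.coe_mul, Real.coe_toNNReal M hM0]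
    ring

end Abstract

/-! ### The generator of the shift semigroup -/

/-- Testing the difference quotient on `∫_a^0` gives `x₀` minus the mean of the extension over `[a,
a + t]`. At almost every `a` this mean tends to `x₁(a)`, so `∫_a^0 y₁ = x₀ - x₁(a)`. -/
theorem isPrimitive_of_tendsto (hw : IsWeight w) {T : ℝ≥0 → Hw w →L[ℝ] Hw w}
    (hT : IsShiftFamily w T) {x y : Hw w}
    (h : Tendsto (fun t : ℝ≥0 => (t : ℝ)⁻¹ • (T t x - x)) (𝓝[>] 0) (𝓝 y)) :
    IsPrimitive x y := by
  refine ⟨?_, ?_⟩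
  · have h1 := ((WithLp.fstL 2 ℝ ℝ (L2w w)).continuous.tendsto y).comp h
    refine tendsto_nhds_unique h1 (tendsto_const_nhds.congr fun t => ?_)
    simp [(hT t x).1]
  · have hl := LocallyIntegrable.ae_hasDerivAt_integral (locallyIntegrable_constExtension hw x)
    filter_upwards [ae_restrict_of_ae hl, ae_restrict_mem measurableSet_Iic] with a h1 ha
    obtain ⟨ℓ, hℓ⟩ := hw.exists_intervalIntegralL ha
    have h2 := ((ℓ.comp (WithLp.sndL 2 ℝ ℝ (L2w w))).continuous.tendsto y).comp h
    have h3 := (h1 a).tendsto_slope_zero_right.comp tendsto_coe_nhdsGT_zero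
    have h4 := h3.const_sub x.fst
    have h5 : ℓ y.snd = x.fst - constExtension x.fst x.snd a := by
      refine tendsto_nhds_unique h2 (h4.congr' ?_)
      filter_upwards [self_mem_nhdsWithin] with t ht
      have ht' : (t : ℝ) ≠ 0 := (NNReal.coe_pos.2 ht).ne'
      have h6 := integral_shift_sub hw hT t x ha
      rw [← hℓ, ← hℓ] at h6
      simp only [Function.comp_apply, map_smul, map_sub, ContinuousLinearMap.comp_apply,
        WithLp.sndL_apply, h6, intervalIntegral.integral_same, smul_eq_mul, sub_zero]
      field_simp
    rw [hℓ, constExtension_of_le ha] at h5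
    have h7 : ∫ η in a..0, (Iic (0 : ℝ)).indicator y.snd η = ∫ η in a..0, y.snd η := by
      refine intervalIntegral.integral_congr fun ξ hξ => ?_
      rw [uIcc_of_le ha] at hξ
      exact indicator_of_mem (mem_Iic.2 hξ.2) _
    rw [intervalIntegral.integral_symm, h7, h5]
    ring

/-- To the right of `0` the integrand vanishes, so the primitive stays at `x₀`, as the extension
does. -/
theorem IsPrimitive.constExtension_ae_eq {x y : Hw w} (h : IsPrimitive x y) :
    constExtension x.fst x.snd =ᵐ[volume]
      fun η => x.fst + ∫ ζ in 0..η, (Iic (0 : ℝ)).indicator y.snd ζ := by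
  filter_upwards [(ae_restrict_iff' measurableSet_Iic).1 h.2] with η hη
  rcases le_or_gt η 0 with h1 | h1
  · rw [constExtension_of_le h1, hη h1]
  · rw [constExtension_of_lt h1, intervalIntegral.integral_congr_uIoo (g := fun _ => 0)]
    · simp
    · intro ζ hζ
      rw [uIoo_of_le h1.le] at hζ
      exact indicator_of_notMem (by simpa using hζ.1) _

/-- After testing on `∫_a^0`, both sides become `t x₀ - ∫_a^{a+t} X`, where `X` is the primitive of
the zero extension of `y₁` with `X(0) = x₀`. -/
theorem IsPrimitive.eq_integral (hw : IsWeight w) {T : ℝ≥0 → Hw w →L[ℝ] Hw w}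
    (hT : IsShiftFamily w T) (hC : IsC0Semigroup T) {x y : Hw w} (h : IsPrimitive x y) (t : ℝ≥0) :
    T t x - x = ∫ s in (0 : ℝ)..t, T s.toNNReal y := by
  have hint : IntervalIntegrable (fun s : ℝ => T s.toNNReal y) volume 0 t :=
    (hC.continuous_toNNReal y).intervalIntegrable _ _
  have hfst : (∫ s in (0 : ℝ)..t, T s.toNNReal y).fst = 0 := by
    have h1 := (WithLp.fstL 2 ℝ ℝ (L2w w)).intervalIntegral_comp_comm hint
    simp only [WithLp.fstL_apply] at h1
    rw [← h1]
    simp [(hT _ y).1, h.1]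
  have hsnd : (T t x - x).snd = (∫ s in (0 : ℝ)..t, T s.toNNReal y).snd := by
    refine L2w.ext_of_intervalIntegral_eq hw fun a ha => ?_
    obtain ⟨ℓ, hℓ⟩ := hw.exists_intervalIntegralL ha
    have h1 := (ℓ.comp (WithLp.sndL 2 ℝ ℝ (L2w w))).intervalIntegral_comp_comm hint
    simp only [ContinuousLinearMap.comp_apply, WithLp.sndL_apply] at h1
    have h2 := integral_shift_sub hw hT t x ha
    rw [← hℓ, ← hℓ, ← map_sub] at h2
    rw [← hℓ, ← hℓ, ← h1, WithLp.sub_snd, h2]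
    have hi := intervalIntegrable_of_locallyIntegrable (hw.locallyIntegrable_indicator y.snd)
    set X : ℝ → ℝ := fun η => x.fst + ∫ ζ in 0..η, (Iic (0 : ℝ)).indicator y.snd ζ with hX
    have hXc : Continuous X :=
      continuous_const.add (intervalIntegral.continuous_primitive hi 0)
    -- Since `y₀ = 0`, the constant extension of `y` is the zero extension. Its integral over `[a +
    -- s, s]` therefore equals the one from `a + s` to `0`, whatever the sign of `a + s`.
    have h3 : ∀ s ∈ uIcc (0 : ℝ) t, ℓ (T s.toNNReal y).snd = x.fst - X (a + s) := by
      intro s hs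
      rw [uIcc_of_le t.coe_nonneg] at hs
      have h4 : constExtension y.fst y.snd = (Iic (0 : ℝ)).indicator y.snd := by
        funext η
        simp [constExtension, h.1]
      have h5 : ∫ ζ in 0..s, (Iic (0 : ℝ)).indicator y.snd ζ = 0 := by
        rw [← h4, h.1, integral_constExtension_nonneg _ _ hs.1, mul_zero]
      rw [hℓ, integral_shift hw hT _ y ha, Real.coe_toNNReal s hs.1, h4, hX,
        ← intervalIntegral.integral_add_adjacent_intervals (hi (s + a) 0) (hi 0 s), h5,
        intervalIntegral.integral_symm, add_comm a s]
      ring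
    have h6 : Continuous fun s => X (a + s) := by fun_prop
    rw [intervalIntegral.integral_congr h3,
      intervalIntegral.integral_sub intervalIntegrable_const (h6.intervalIntegrable _ _),
      intervalIntegral.integral_const, intervalIntegral.integral_comp_add_left,
      intervalIntegral.integral_congr_ae (g := X)
        (h.constExtension_ae_eq.mono fun η hη _ => hη)]
    simp
  refine WithLp.ofLp_injective 2 (Prod.ext ?_ hsnd)
  refine Eq.trans ?_ hfst.symm
  change (T t x - x).fst = 0
  rw [WithLp.sub_fst, (hT t x).1, sub_self]

theorem isGenerator_opA (hw : IsWeight w) {T : ℝ≥0 → Hw w →L[ℝ] Hw w}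
    (hT : IsShiftFamily w T) (hC : IsC0Semigroup T) : IsGenerator T (opA w hw) := by
  have h : ∀ x : (opA w hw).domain,
      Tendsto (fun t : ℝ≥0 => (t : ℝ)⁻¹ • (T t (x : Hw w) - (x : Hw w))) (𝓝[>] 0)
        (𝓝 (opA w hw x)) := fun x =>
    hC.tendsto_of_eq_integral ((isPrimitive_opA hw x).eq_integral hw hT hC)
  refine ⟨fun x => ⟨fun hx => ⟨_, h ⟨x, hx⟩⟩, ?_⟩, h⟩
  rintro ⟨y, hy⟩
  obtain ⟨x', rfl, -⟩ := (isPrimitive_of_tendsto hw hT hy).exists_opA_eq hw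
  exact x'.2

/-- The graph is cut out by the integral identities for all `t`, each an equality of continuous
functions of `(x, y)`. -/
theorem isClosed_opA (hw : IsWeight w) {T : ℝ≥0 → Hw w →L[ℝ] Hw w}
    (hT : IsShiftFamily w T) (hC : IsC0Semigroup T) : (opA w hw).IsClosed := by
  have h : ((opA w hw).graph : Set (Hw w × Hw w))
      = ⋂ t : ℝ≥0, {p | T t p.1 - p.1 = ∫ s in (0 : ℝ)..t, T s.toNNReal p.2} := by
    ext ⟨x, y⟩
    simp only [SetLike.mem_coe, LinearPMap.mem_graph_iff, mem_iInter, mem_ofPred_eq]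
    constructor
    · rintro ⟨x', rfl, rfl⟩ t
      exact (isPrimitive_opA hw x').eq_integral hw hT hC t
    · exact fun h => (isPrimitive_of_tendsto hw hT (hC.tendsto_of_eq_integral h)).exists_opA_eq hw
  rw [LinearPMap.IsClosed, h]
  refine isClosed_iInter fun t => isClosed_eq ?_ ?_
  · exact ((T t).continuous.comp continuous_fst).sub continuous_fst
  · exact (hC.continuous_integral t).comp continuous_snd

/-! ### Unboundedness -/

theorem exists_isPrimitive_ramp (hw : IsWeight w) {n : ℝ} (hn : 0 < n) :
    ∃ x y : Hw w, IsPrimitive x y ∧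
      ‖x‖ ≤ 1 + (weightMeasure w).real (Ioc (-n⁻¹) 0) ^ (1 / 2 : ℝ) ∧
      ‖y‖ = n * (weightMeasure w).real (Ioc (-n⁻¹) 0) ^ (1 / 2 : ℝ) := by
  have := hw.isLocallyFiniteMeasure
  have hfin : weightMeasure w (Ioc (-n⁻¹) 0) ≠ ∞ := measure_Ioc_lt_top.ne
  -- The ramp rises from `0` at `-1/n` to `1` at `0`, with slope `n`. It is dominated by the
  -- indicator of `(-1/n, 0]`, while its derivative is `n` times that indicator.
  set f : ℝ → ℝ := fun ξ => 1 + n * max ξ (-n⁻¹) with hf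
  have hfb : ∀ ξ ≤ 0, ‖f ξ‖ ≤ ‖(Ioc (-n⁻¹) 0).indicator (fun _ => (1 : ℝ)) ξ‖ := by
    intro ξ hξ
    have hnn : n * n⁻¹ = 1 := mul_inv_cancel₀ hn.ne'
    by_cases h : ξ ∈ Ioc (-n⁻¹) 0
    · rw [indicator_of_mem h, hf]
      simp only [max_eq_left h.1.le, norm_one, Real.norm_eq_abs]
      rw [abs_le]
      have h1 := mul_lt_mul_of_pos_left h.1 hn
      have h2 := mul_nonpos_of_nonneg_of_nonpos hn.le hξ
      constructor <;> linarith
    · have h1 : ξ ≤ -n⁻¹ := by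
        by_contra h2
        exact h ⟨not_le.1 h2, hξ⟩
      rw [hf]
      simp only [max_eq_right h1, mul_neg, hnn]
      simp
  have hfae : ∀ᵐ ξ ∂weightMeasure w, ‖f ξ‖ ≤ ‖(Ioc (-n⁻¹) 0).indicator (fun _ => (1 : ℝ)) ξ‖ :=
    ae_weightMeasure_le_zero.mono hfb
  have hfm : MemLp f 2 (weightMeasure w) :=
    (memLp_indicator_const 2 measurableSet_Ioc (1 : ℝ) (Or.inr hfin)).mono
      (Continuous.aestronglyMeasurable (by fun_prop)) hfae
  refine ⟨WithLp.toLp 2 (1, hfm.toLp f),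
    WithLp.toLp 2 (0, indicatorConstLp 2 measurableSet_Ioc hfin n), ⟨rfl, ?_⟩, ?_, ?_⟩
  · filter_upwards [hw.ae_eq hfm.coeFn_toLp, ae_restrict_mem measurableSet_Iic] with ξ h1 h2
    have h2' : ξ ≤ 0 := h2
    have h3 := hw.ae_eq (indicatorConstLp_coeFn (p := 2) (hs := measurableSet_Ioc) (hμs := hfin)
      (c := n))
    change hfm.toLp f ξ = 1 + ∫ η in 0..ξ, (Iic (0 : ℝ)).indicator
      (indicatorConstLp 2 measurableSet_Ioc hfin n : L2w w) η
    have h4 : ∫ η in ξ..0, (Iic (0 : ℝ)).indicator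
        (indicatorConstLp 2 measurableSet_Ioc hfin n : L2w w) η
        = ∫ η in Ioc ξ 0, (Ioc (-n⁻¹) 0).indicator (fun _ => n) η := by
      rw [intervalIntegral.integral_of_le h2']
      refine integral_congr_ae ?_
      filter_upwards [ae_restrict_of_ae_restrict_of_subset Ioc_subset_Iic_self h3,
        ae_restrict_mem measurableSet_Ioc] with η h5 h6
      rw [indicator_of_mem (Ioc_subset_Iic_self h6), h5]
    have h7 : max ξ (-n⁻¹) ≤ 0 := max_le h2' (by simp [hn.le])
    rw [h1, intervalIntegral.integral_symm, h4, setIntegral_indicator measurableSet_Ioc,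
      Ioc_inter_Ioc, setIntegral_const, min_self, Real.volume_real_Ioc_of_le h7, hf]
    simp only [smul_eq_mul]
    ring
  · have h1 : ‖hfm.toLp f‖ ≤ (weightMeasure w).real (Ioc (-n⁻¹) 0) ^ (1 / 2 : ℝ) := by
      have h2 : ‖hfm.toLp f‖ ≤ ‖indicatorConstLp 2 measurableSet_Ioc hfin (1 : ℝ)‖ := by
        refine Lp.norm_le_norm_of_ae_le ?_
        filter_upwards [hfm.coeFn_toLp, hfae, indicatorConstLp_coeFn (p := 2)
          (hs := measurableSet_Ioc) (hμs := hfin) (c := (1 : ℝ))] with ξ h3 h4 h5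
        rwa [h3, h5]
      rw [norm_indicatorConstLp (by norm_num) (by norm_num)] at h2
      simpa using h2
    have h3 : (WithLp.toLp 2 ((1 : ℝ), hfm.toLp f) : Hw w)
        = WithLp.toLp 2 ((1 : ℝ), (0 : L2w w)) + WithLp.toLp 2 ((0 : ℝ), hfm.toLp f) := by
      rw [← WithLp.toLp_add]; simp
    rw [h3]
    refine (norm_add_le _ _).trans ?_
    rw [WithLp.norm_toLp_fst, WithLp.norm_toLp_snd, norm_one]
    gcongr
  · rw [WithLp.norm_toLp_snd, norm_indicatorConstLp (by norm_num) (by norm_num)]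
    simp [abs_of_pos hn]

/-- With `m ≤ w ≤ M` on `[-1, 0]`, the mass `r` of `(-1/n, 0]` satisfies `m/n ≤ r ≤ M`. The ramps
thus have norm at most `1 + √M`, while the squared norms of their images, `n² r ≥ n m`, grow without
bound. -/
theorem not_bounded_opA (hw : IsWeight w) :
    ¬ ∃ C : ℝ, ∀ x : (opA w hw).domain, ‖opA w hw x‖ ≤ C * ‖(x : Hw w)‖ := by
  rintro ⟨C, hC⟩
  obtain ⟨m, M, hm, hM, h⟩ := hw.exists_between_Icc (a := -1) (by norm_num)
  set D : ℝ := |C| * (1 + M ^ (1 / 2 : ℝ)) with hD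
  have hD0 : 0 ≤ D := by positivity
  -- `n ≥ 1` keeps the ramp inside `[-1, 0]`; the other bound gives `n m ≥ D² + 1`, against the `n m
  -- ≤ D²` that boundedness would force.
  set n : ℝ := max 1 ((D ^ 2 + 1) / m) with hn
  have hn1 : 1 ≤ n := le_max_left _ _
  have hn0 : 0 < n := one_pos.trans_le hn1
  have hnm : D ^ 2 + 1 ≤ n * m := (div_le_iff₀ hm).1 (le_max_right _ _)
  have hinv : n⁻¹ ≤ 1 := inv_le_one_of_one_le₀ hn1
  have hsub : Ioc (-n⁻¹) 0 ⊆ Icc (-1) 0 := fun ξ hξ => ⟨by linarith [hξ.1], hξ.2⟩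
  have hvol : volume (Ioc (-n⁻¹) 0) = ENNReal.ofReal n⁻¹ := by simp
  obtain ⟨x, y, hxy, hx, hy⟩ := exists_isPrimitive_ramp hw hn0
  obtain ⟨x', rfl, rfl⟩ := hxy.exists_opA_eq hw
  set r : ℝ := (weightMeasure w).real (Ioc (-n⁻¹) 0) with hr
  have hup := weightMeasure_le_of_subset_Icc (fun ξ hξ => (h ξ hξ).2) measurableSet_Ioc
    (inter_subset_left.trans hsub)
  have hlow := le_weightMeasure_of_subset_Icc (fun ξ hξ => (h ξ hξ).1) measurableSet_Ioc hsub
  rw [hvol, ← ENNReal.ofReal_mul hM.le] at hup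
  rw [hvol, ← ENNReal.ofReal_mul hm.le] at hlow
  have hrM : r ≤ M := by
    refine (ENNReal.toReal_le_of_le_ofReal (by positivity) hup).trans ?_
    exact mul_le_of_le_one_right hM.le hinv
  have hrm : m * n⁻¹ ≤ r :=
    (ENNReal.ofReal_le_iff_le_toReal (ne_top_of_le_ne_top ENNReal.ofReal_ne_top hup)).1 hlow
  have hr0 : 0 ≤ r := measureReal_nonneg
  have hrs : (r ^ (1 / 2 : ℝ)) ^ 2 = r := by
    rw [← Real.sqrt_eq_rpow, Real.sq_sqrt hr0]
  have h1 : n * r ^ (1 / 2 : ℝ) ≤ D := by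
    rw [← hy]
    refine (hC x').trans ((mul_le_mul_of_nonneg_right (le_abs_self C) (norm_nonneg _)).trans ?_)
    rw [hD]
    gcongr
    exact hx.trans (by gcongr)
  have h2 : (n * r ^ (1 / 2 : ℝ)) ^ 2 ≤ D ^ 2 := by gcongr
  rw [mul_pow, hrs] at h2
  have h3 : n * m ≤ n ^ 2 * r := by
    calc n * m = n ^ 2 * (m * n⁻¹) := by field_simp
      _ ≤ n ^ 2 * r := by gcongr
  linarith

end DelayShift

theorem mainTheorem7 (w : ℝ → ℝ) (hw : DelayShift.IsWeight w) :
    ∃ T : ℝ≥0 → DelayShift.Hw w →L[ℝ] DelayShift.Hw w,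
      DelayShift.IsShiftFamily w T ∧
      DelayShift.IsC0Semigroup T ∧
      DelayShift.IsGenerator T (DelayShift.opA w hw) ∧
      (DelayShift.opA w hw).IsClosed ∧
      ¬ ∃ C : ℝ, ∀ x : (DelayShift.opA w hw).domain,
        ‖DelayShift.opA w hw x‖ ≤ C * ‖(x : DelayShift.Hw w)‖ := by
  obtain ⟨T, hT, hc⟩ := DelayShift.exists_isShiftFamily hw
  have hC := hT.isC0Semigroup hw hc
  exact ⟨T, hT, hC, DelayShift.isGenerator_opA hw hT hC, DelayShift.isClosed_opA hw hT hC,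
    DelayShift.not_bounded_opA hw⟩
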